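/- Let $\Bbbk$ be a field of characteristic zero, let $n \geq 4$ and $d \geq 3$ be integers, and let $S=\Bbbk[x_1,\ldots,x_n]$ with the standard grading. Then for every integer $\mu$ with $n+2 \leq \mu \leq \binom{n+d-2}{d}$ there exists an ideal $I \subset S$, minimally generated by $\mu$ monomials of degree $d$, such that $A=S/I$ is artinian and fails the weak Lefschetz property; that is, there is no linear form $\ell \in A_1$ such that for every $i \geq 0$ the multiplication map $\times \ell : A_i \to A_{i+1}$ has maximal rank (is injective or surjective). -/

import Mathlib

/-- The ideal of `k[x_i : i ∈ σ]` generated by the monomials `x ^ m`, `m ∈ T`. -/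
noncomputable def monomialIdeal (k : Type*) [Field k] {σ : Type*} (T : Set (σ →₀ ℕ)) :
    Ideal (MvPolynomial σ k) :=
  Ideal.span ((fun m => MvPolynomial.monomial m (1 : k)) '' T)

/-- `I` is a monomial ideal minimally generated by `μ` monomials of degree `d`: it is generated by
a set of exactly `μ` monomials of degree `d`, and no proper subset of them generates `I`. -/
def IsMinimallyGeneratedByMonomials {k : Type*} [Field k] {σ : Type*}
    (I : Ideal (MvPolynomial σ k)) (d μ : ℕ) : Prop :=
  ∃ T : Finset (σ →₀ ℕ),
    (∀ m ∈ T, m.degree = d) ∧ T.card = μ ∧ I = monomialIdeal k (T : Set (σ →₀ ℕ)) ∧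
    ∀ T' : Finset (σ →₀ ℕ), T' ⊂ T → monomialIdeal k (T' : Set (σ →₀ ℕ)) ≠ I

/-- The degree `i` piece `A_i` of `A = k[x_i : i ∈ σ] / I` (for homogeneous `I`): the image of the
space of forms of degree `i`. -/
noncomputable def gradedPiece {k : Type*} [Field k] {σ : Type*} (I : Ideal (MvPolynomial σ k)) (i : ℕ) :
    Submodule k (MvPolynomial σ k ⧸ I) :=
  (MvPolynomial.homogeneousSubmodule σ k i).map (Ideal.Quotient.mkₐ k I).toLinearMap

theorem mul_mem_gradedPiece {k : Type*} [Field k] {σ : Type*} {I : Ideal (MvPolynomial σ k)}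
    {i : ℕ} {l a : MvPolynomial σ k ⧸ I} (hl : l ∈ gradedPiece I 1) (ha : a ∈ gradedPiece I i) :
    l * a ∈ gradedPiece I (i + 1) := by
  obtain ⟨p, hp, rfl⟩ := hl
  obtain ⟨q, hq, rfl⟩ := ha
  refine ⟨p * q, ?_, by simp⟩
  have h : (p * q).IsHomogeneous (1 + i) := MvPolynomial.IsHomogeneous.mul hp hq
  rw [add_comm] at h
  exact h

/-- Multiplication by a linear form `l ∈ A_1`, as a linear map `A_i → A_{i+1}`. -/
noncomputable def mulLinearForm {k : Type*} [Field k] {σ : Type*} (I : Ideal (MvPolynomial σ k))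
    (l : gradedPiece I 1) (i : ℕ) : gradedPiece I i →ₗ[k] gradedPiece I (i + 1) :=
  (LinearMap.mulLeft k (l : MvPolynomial σ k ⧸ I)).restrict
    (fun _ ha => mul_mem_gradedPiece l.2 ha)

/-- The weak Lefschetz property of the graded algebra `A = k[x_i : i ∈ σ] / I`: there is a linear
form `l ∈ A_1` such that multiplication by `l` from `A_i` to `A_{i+1}` has maximal rank, that is,
is injective or surjective, for every `i`. -/
def HasWLP {k : Type*} [Field k] {σ : Type*} (I : Ideal (MvPolynomial σ k)) : Prop :=
  ∃ l : gradedPiece I 1, ∀ i : ℕ,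
    Function.Injective (mulLinearForm I l i) ∨ Function.Surjective (mulLinearForm I l i)

/-!
For a set `T` of monomials of degree `d` containing all pure powers, the weak Lefschetz property
fails as soon as there is a degree `j` such that for every linear form `ℓ` two witnesses exist: a
form `f ∉ I` of degree `j` with `ℓ * f ∈ I` (`FailsInjectivity`), and a nonzero functional on the
forms of degree `j + 1` vanishing on `I` and on the multiples of `ℓ` (`FailsSurjectivity`). Both
kinds of witnesses multiply when sets of generators in disjoint sets of variables are put together
(`FailsInjectivity.join`, `FailsSurjectivity.join`). Forms and functionals are given by their values
on exponent vectors `Fin n → ℕ`.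

If `2 * n - 1 ≤ μ`, let `T` contain all `x_0 ^ (d - 1) * x_i`. Then `x_0 ^ (d - 1)` is killed by every
linear form, and the upper bound on `μ` says precisely that the dimension of the quotient does not
drop from degree `d - 1` to degree `d`, so that multiplication is not surjective there either
(`hasFailingGenerators_of_le`).

For `μ ≤ 2 * n - 2` the generators are built up two variables at a time. On `k[x, y]`, a linear form
has both witnesses in the degree `d - 1`, whichever monomials of degree `d` are added to `x ^ d` and
`y ^ d`. So two variables can be added along with two, three or four generators
(`HasFailingGenerators.add_two`). The starting points are:

* `n = 3`, `d ≥ 4`: the five monomials `x ^ d, y ^ d, z ^ d, x ^ (d - 1) * y, x ^ (d - 1) * z`;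
* `n = 3`, `d = 3`: the monomials `x ^ 3, y ^ 3, z ^ 3, x * y * z`, because `x + y + z` divides
  `x ^ 3 + y ^ 3 + z ^ 3 - 3 * x * y * z`;
* `n = 4`: the pure powers with `x ^ (d - 1) * y` and `x * y ^ (d - 1)`. Here the product of the
  functionals for `x, y` and `z, w` has degree `2 * d - 2`, and a form of degree `2 * d - 3` is killed
  because of the identity `(u + v) * (u ^ 2 - u * v + v ^ 2) = u ^ 3 + v ^ 3`
  (`failsInjectivity_outerPair_join`).
-/

/-! ### Witnesses against injectivity and surjectivity -/

/-- `m` is divisible by one of the monomials in `T`. -/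
def IsMultipleOf {n : ℕ} (T : Finset (Fin n → ℕ)) (m : Fin n → ℕ) : Prop := ∃ t ∈ T, t ≤ m

/-- Multiplication by the linear form `∑ i, a i * x_i`, on families of coefficients. -/
def mulLin {k : Type*} [Field k] {n : ℕ} (a : Fin n → k) :
    Module.End k ((Fin n → ℕ) → k) where
  toFun f m := ∑ i, if m i = 0 then 0 else a i * f (m - Pi.single i 1)
  map_add' f g := by
    funext m
    simp only [Pi.add_apply, ← Finset.sum_add_distrib]
    refine Finset.sum_congr rfl fun i _ => ?_
    split_ifs <;> ring
  map_smul' c f := by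
    funext m
    simp only [Pi.smul_apply, smul_eq_mul, RingHom.id_apply, Finset.mul_sum]
    refine Finset.sum_congr rfl fun i _ => ?_
    split_ifs <;> ring

theorem mulLin_apply {k : Type*} [Field k] {n : ℕ} (a : Fin n → k) (f : (Fin n → ℕ) → k)
    (m : Fin n → ℕ) :
    mulLin a f m = ∑ i, if m i = 0 then 0 else a i * f (m - Pi.single i 1) := rfl

/-- There is a form `f` of degree `j`, given by its coefficients, that lies outside the ideal
generated by `T` although its product with `∑ i, a i * x_i` lies in this ideal. -/
def FailsInjectivity {k : Type*} [Field k] {n : ℕ} (a : Fin n → k) (T : Finset (Fin n → ℕ))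
    (j : ℕ) : Prop :=
  ∃ f : (Fin n → ℕ) → k, (∀ m, f m ≠ 0 → ∑ i, m i = j) ∧ (∃ m, f m ≠ 0 ∧ ¬ IsMultipleOf T m) ∧
    ∀ m, ¬ IsMultipleOf T m → mulLin a f m = 0

/-- There is a nonzero functional on the forms of degree `j`, given by its values `φ m` on the
monomials, that vanishes on the ideal generated by `T` and on all multiples of the linear form
`∑ i, a i * x_i`. So multiplication by this form is not onto in degree `j`. -/
def FailsSurjectivity {k : Type*} [Field k] {n : ℕ} (a : Fin n → k) (T : Finset (Fin n → ℕ))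
    (j : ℕ) : Prop :=
  ∃ φ : (Fin n → ℕ) → k, (∀ m, φ m ≠ 0 → ∑ i, m i = j ∧ ¬ IsMultipleOf T m) ∧ (∃ m, φ m ≠ 0) ∧
    ∀ m : Fin n → ℕ, ∑ i, a i * φ (m + (Pi.single i 1 : Fin n → ℕ)) = 0

theorem sum_add_single {n : ℕ} (m : Fin n → ℕ) (i : Fin n) :
    ∑ l, (m + (Pi.single i 1 : Fin n → ℕ)) l = ∑ l, m l + 1 := by
  simp [Finset.sum_add_distrib]

theorem sub_single_add_single {n : ℕ} {m : Fin n → ℕ} {i : Fin n} (h : m i ≠ 0) :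
    m - (Pi.single i 1 : Fin n → ℕ) + Pi.single i 1 = m := by
  refine tsub_add_cancel_of_le fun l => ?_
  by_cases hl : l = i
  · subst hl; simp; omega
  · simp [hl]

theorem sum_of_mulLin_ne_zero {k : Type*} [Field k] {n : ℕ} {a : Fin n → k}
    {f : (Fin n → ℕ) → k} {j : ℕ} (hf : ∀ m, f m ≠ 0 → ∑ i, m i = j)
    {m : Fin n → ℕ} (hm : mulLin a f m ≠ 0) :
    ∑ i, m i = j + 1 := by
  obtain ⟨i, -, hi⟩ :=
    Finset.exists_ne_zero_of_sum_ne_zero ((mulLin_apply a f m).symm.trans_ne hm)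
  split_ifs at hi with h0
  · exact absurd rfl hi
  · have h1 := hf _ (right_ne_zero_of_mul hi)
    rw [← sub_single_add_single h0, sum_add_single, h1]

/-! ### From coefficient families to the quotient algebra -/

open MvPolynomial in
theorem coeff_linearForm_mul {k : Type*} [Field k] {n : ℕ} (a : Fin n → k)
    (p : MvPolynomial (Fin n) k) (m : Fin n → ℕ) :
    coeff (Finsupp.equivFunOnFinite.symm m) ((∑ i, C (a i) * X i) * p) =
      mulLin a (fun m' => coeff (Finsupp.equivFunOnFinite.symm m') p) m := by
  rw [Finset.sum_mul, coeff_sum, mulLin_apply]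
  refine Finset.sum_congr rfl fun i _ => ?_
  rw [mul_assoc, coeff_C_mul, coeff_X_mul']
  have : Finsupp.equivFunOnFinite.symm m - Finsupp.single i 1 =
      Finsupp.equivFunOnFinite.symm (m - Pi.single i 1) := by
    ext l
    simp [Finsupp.single_apply, Pi.single_apply, eq_comm]
  rw [this]
  by_cases h : m i = 0 <;> simp [h]

open MvPolynomial in
/-- The polynomial with the given coefficients in degree `j`. -/
noncomputable def formOfCoeffs {k : Type*} [Field k] {n : ℕ} (j : ℕ) (f : (Fin n → ℕ) → k) :
    MvPolynomial (Fin n) k :=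
  ∑ m ∈ Finset.Nat.antidiagonalTuple n j, monomial (Finsupp.equivFunOnFinite.symm m) (f m)

open MvPolynomial in
theorem coeff_formOfCoeffs {k : Type*} [Field k] {n j : ℕ} {f : (Fin n → ℕ) → k}
    (hf : ∀ m, f m ≠ 0 → ∑ i, m i = j) (m : Fin n → ℕ) :
    coeff (Finsupp.equivFunOnFinite.symm m) (formOfCoeffs j f) = f m := by
  simp only [formOfCoeffs, coeff_sum, coeff_monomial, EmbeddingLike.apply_eq_iff_eq]
  rw [Finset.sum_ite_eq']
  split_ifs with h
  · rfl
  · by_contra h0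
    exact h (Finset.Nat.mem_antidiagonalTuple.2 (hf m (Ne.symm h0)))

open MvPolynomial in
theorem isHomogeneous_formOfCoeffs {k : Type*} [Field k] {n : ℕ} (j : ℕ) (f : (Fin n → ℕ) → k) :
    (formOfCoeffs j f).IsHomogeneous j := by
  refine IsHomogeneous.sum _ _ _ fun m hm => isHomogeneous_monomial _ ?_
  rw [Finset.Nat.mem_antidiagonalTuple] at hm
  simpa [Finsupp.degree_eq_sum] using hm

/-- The exponent vectors in `T`, as finitely supported functions. -/
noncomputable def exponents {n : ℕ} (T : Finset (Fin n → ℕ)) : Finset (Fin n →₀ ℕ) :=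
  T.map Finsupp.equivFunOnFinite.symm.toEmbedding

open MvPolynomial in
theorem mem_monomialIdeal_exponents {k : Type*} [Field k] {n : ℕ} {T : Finset (Fin n → ℕ)}
    {p : MvPolynomial (Fin n) k} :
    p ∈ monomialIdeal k (exponents T : Set (Fin n →₀ ℕ)) ↔
      ∀ m, ¬ IsMultipleOf T m → coeff (Finsupp.equivFunOnFinite.symm m) p = 0 := by
  rw [monomialIdeal, mem_ideal_span_monomial_image]
  constructor
  · intro h m hm
    by_contra h0
    obtain ⟨s, hs, hle⟩ := h _ (mem_support_iff.2 h0)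
    simp only [exponents, Finset.coe_map, Set.mem_image] at hs
    obtain ⟨t, ht, rfl⟩ := hs
    exact hm ⟨t, ht, fun i => hle i⟩
  · intro h x hx
    by_contra hc
    refine mem_support_iff.1 hx ?_
    have := h (Finsupp.equivFunOnFinite x) ?_
    · simpa using this
    · rintro ⟨t, ht, hle⟩
      refine hc ⟨Finsupp.equivFunOnFinite.symm t, ?_, fun i => hle i⟩
      simpa [exponents] using ht

open MvPolynomial in
theorem exists_linearForm {k : Type*} [Field k] {n : ℕ} {p : MvPolynomial (Fin n) k}
    (hp : p ∈ homogeneousSubmodule (Fin n) k 1) : ∃ a : Fin n → k, p = ∑ i, C (a i) * X i := by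
  rw [homogeneousSubmodule_one_eq_span_X, Submodule.mem_span_range_iff_exists_fun] at hp
  obtain ⟨a, rfl⟩ := hp
  exact ⟨a, by simp [C_mul']⟩

open MvPolynomial in
theorem not_hasWLP_of_fails {k : Type*} [Field k] {n j : ℕ} {T : Finset (Fin n → ℕ)}
    (h : ∀ a : Fin n → k, FailsInjectivity a T j ∧ FailsSurjectivity a T (j + 1)) :
    ¬ HasWLP (monomialIdeal k (exponents T : Set (Fin n →₀ ℕ))) := by
  set I := monomialIdeal k (exponents T : Set (Fin n →₀ ℕ)) with hI
  rintro ⟨⟨l, p, hp, rfl⟩, hl⟩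
  obtain ⟨a, rfl⟩ := exists_linearForm hp
  obtain ⟨⟨f, hfj, ⟨m₀, hm₀, hm₀T⟩, hf⟩, φ, hφj, ⟨m₁, hm₁⟩, hφ⟩ := h a
  rcases hl j with hinj | hsurj
  · have hmem : Ideal.Quotient.mkₐ k I (formOfCoeffs j f) ∈ gradedPiece I j :=
      ⟨_, isHomogeneous_formOfCoeffs j f, rfl⟩
    have hz : (⟨_, hmem⟩ : gradedPiece I j) = 0 := by
      apply hinj
      rw [map_zero]
      apply Subtype.ext
      change Ideal.Quotient.mk I (∑ i, C (a i) * X i) * Ideal.Quotient.mk I (formOfCoeffs j f) = 0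
      rw [← map_mul, Ideal.Quotient.eq_zero_iff_mem, hI, mem_monomialIdeal_exponents]
      intro m hm
      rw [coeff_linearForm_mul]
      simpa only [coeff_formOfCoeffs hfj] using hf m hm
    have hz' : Ideal.Quotient.mk I (formOfCoeffs j f) = 0 := congrArg Subtype.val hz
    rw [Ideal.Quotient.eq_zero_iff_mem, hI, mem_monomialIdeal_exponents] at hz'
    exact hm₀ (by simpa only [coeff_formOfCoeffs hfj] using hz' m₀ hm₀T)
  · let Φ : MvPolynomial (Fin n) k →ₗ[k] k :=
      (basisMonomials (Fin n) k).constr k fun m => φ (Finsupp.equivFunOnFinite m)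
    have hΦ : ∀ (m : Fin n →₀ ℕ) (c : k),
        Φ (monomial m c) = c * φ (Finsupp.equivFunOnFinite m) := by
      intro m c
      have h1 : monomial m c = c • (basisMonomials (Fin n) k) m := by
        simp [smul_monomial]
      rw [h1, map_smul, Module.Basis.constr_basis, smul_eq_mul]
    have hΦI : ∀ q ∈ I, Φ q = 0 := by
      intro q hq
      rw [q.as_sum, map_sum]
      refine Finset.sum_eq_zero fun m hm => ?_
      rw [hΦ]
      refine mul_eq_zero_of_right _ ?_
      by_contra h0
      have := mem_monomialIdeal_exponents.1 (hI ▸ hq) _ (hφj _ h0).2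
      simp only [Equiv.symm_apply_apply] at this
      exact mem_support_iff.1 hm this
    have hΦL : ∀ q, Φ ((∑ i, C (a i) * X i) * q) = 0 := by
      intro q
      induction q using MvPolynomial.induction_on' with
      | monomial m c =>
        rw [Finset.sum_mul, map_sum]
        have h2 := congrArg (c * ·) (hφ (Finsupp.equivFunOnFinite m))
        simp only [mul_zero, Finset.mul_sum] at h2
        rw [← h2]
        refine Finset.sum_congr rfl fun i _ => ?_
        have h3 : C (a i) * X i * monomial m c = monomial (m + Finsupp.single i 1) (c * a i) := by
          rw [X, C_mul_monomial, monomial_mul, add_comm]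
          congr 1; ring
        have h4 : Finsupp.equivFunOnFinite (m + Finsupp.single i 1) =
            Finsupp.equivFunOnFinite m + Pi.single i 1 := by
          ext l
          simp [Finsupp.single_apply, Pi.single_apply, eq_comm]
        rw [h3, hΦ, h4]; ring
      | add p q hp hq => rw [mul_add, map_add, hp, hq, add_zero]
    obtain ⟨hd₁, -⟩ := hφj m₁ hm₁
    have hmem : Ideal.Quotient.mkₐ k I (monomial (Finsupp.equivFunOnFinite.symm m₁) 1) ∈
        gradedPiece I (j + 1) := by
      refine ⟨_, isHomogeneous_monomial _ ?_, rfl⟩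
      simpa [Finsupp.degree_eq_sum] using hd₁
    obtain ⟨⟨g, q, hq, rfl⟩, hg⟩ := hsurj ⟨_, hmem⟩
    have hg' : Ideal.Quotient.mk I (∑ i, C (a i) * X i) * Ideal.Quotient.mk I q =
        Ideal.Quotient.mk I (monomial (Finsupp.equivFunOnFinite.symm m₁) 1) :=
      congrArg Subtype.val hg
    rw [← map_mul, Ideal.Quotient.mk_eq_mk_iff_sub_mem] at hg'
    have := hΦI _ hg'
    rw [map_sub, hΦL, hΦ] at this
    simp at this
    exact hm₁ this

/-! ### Minimal generators and the artinian property -/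

theorem isMinimallyGenerated_monomialIdeal (k : Type*) [Field k] {σ : Type*} {d : ℕ}
    {T : Finset (σ →₀ ℕ)} (hT : ∀ m ∈ T, m.degree = d) :
    IsMinimallyGeneratedByMonomials (monomialIdeal k (T : Set (σ →₀ ℕ))) d T.card := by
  refine ⟨T, hT, rfl, rfl, fun T' hT' h => ?_⟩
  obtain ⟨m, hm, hm'⟩ := Finset.exists_of_ssubset hT'
  have hmem : MvPolynomial.monomial m (1 : k) ∈ monomialIdeal k (T : Set (σ →₀ ℕ)) :=
    Ideal.subset_span ⟨m, hm, rfl⟩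
  rw [← h, monomialIdeal, MvPolynomial.mem_ideal_span_monomial_image] at hmem
  obtain ⟨t, ht, htm⟩ := hmem m (by classical simp [MvPolynomial.coeff_monomial])
  obtain ⟨c, rfl⟩ := exists_add_of_le htm
  have h1 := hT _ hm
  rw [map_add, hT t (hT'.1 ht), Nat.add_eq_left, Finsupp.degree_eq_zero_iff] at h1
  subst h1
  simp at hm'
  exact hm' ht

open MvPolynomial in
theorem isArtinianRing_quotient_of_X_pow_mem {k : Type*} [Field k] {n d : ℕ}
    {I : Ideal (MvPolynomial (Fin n) k)} (h : ∀ i, X i ^ (d + 1) ∈ I) :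
    IsArtinianRing (MvPolynomial (Fin n) k ⧸ I) := by
  have hint : Algebra.IsIntegral k (MvPolynomial (Fin n) k ⧸ I) := by
    refine ⟨fun x => ?_⟩
    obtain ⟨p, rfl⟩ := Ideal.Quotient.mkₐ_surjective k I x
    induction p using MvPolynomial.induction_on with
    | C c =>
      have : Ideal.Quotient.mkₐ k I (C c) = algebraMap k _ c := rfl
      rw [this]
      exact isIntegral_algebraMap
    | add p q hp hq => rw [map_add]; exact hp.add hq
    | mul_X p i hp =>
      rw [map_mul]
      refine hp.mul (IsIntegral.of_pow (Nat.succ_pos d) ?_)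
      have : Ideal.Quotient.mkₐ k I (X i) ^ (d + 1) = 0 := by
        rw [← map_pow]
        exact Ideal.Quotient.eq_zero_iff_mem.2 (h i)
      rw [Nat.succ_eq_add_one, this]
      exact isIntegral_zero
  have : Module.Finite k (MvPolynomial (Fin n) k ⧸ I) := Algebra.IsIntegral.finite
  exact IsArtinianRing.of_finite k _

/-! ### Counting monomials -/

theorem card_antidiagonalTuple (n j : ℕ) :
    (Finset.Nat.antidiagonalTuple n j).card = (n + j - 1).choose j := by
  have h := Finset.card_finsuppAntidiag_nat_eq_choose (s := (Finset.univ : Finset (Fin n))) j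
  rw [Finset.card_univ, Fintype.card_fin] at h
  rw [← h]
  refine Finset.card_bij' (fun m _ => Finsupp.equivFunOnFinite.symm m)
    (fun m _ => Finsupp.equivFunOnFinite m) ?_ ?_ ?_ ?_
  · intro m hm
    simpa [Finset.mem_finsuppAntidiag, Finset.Nat.mem_antidiagonalTuple] using hm
  · intro m hm
    simpa [Finset.mem_finsuppAntidiag, Finset.Nat.mem_antidiagonalTuple] using hm
  · intro m _; simp
  · intro m _; simp

theorem eq_of_le_of_sum_eq {n : ℕ} {t m : Fin n → ℕ} (hle : t ≤ m) (h : ∑ i, t i = ∑ i, m i) :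
    t = m :=
  funext fun i => (Finset.sum_eq_sum_iff_of_le fun i _ => hle i).1 h i (Finset.mem_univ i)

theorem isMultipleOf_iff_mem {n d : ℕ} {T : Finset (Fin n → ℕ)} (hT : ∀ t ∈ T, ∑ i, t i = d)
    {m : Fin n → ℕ} (hm : ∑ i, m i = d) : IsMultipleOf T m ↔ m ∈ T := by
  constructor
  · rintro ⟨t, ht, hle⟩
    rwa [← eq_of_le_of_sum_eq hle ((hT t ht).trans hm.symm)]
  · exact fun h => ⟨m, h, le_rfl⟩

theorem not_isMultipleOf_of_lt {n d : ℕ} {T : Finset (Fin n → ℕ)} (hT : ∀ t ∈ T, ∑ i, t i = d)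
    {m : Fin n → ℕ} (hm : ∑ i, m i < d) : ¬ IsMultipleOf T m := by
  rintro ⟨t, ht, hle⟩
  have := Finset.sum_le_sum fun i (_ : i ∈ Finset.univ) => hle i
  rw [hT t ht] at this
  omega

/-- Multiplication by a linear form and the operator `φ ↦ (m ↦ ∑ i, a i * φ (m * x_i))` on
functionals are adjoint to each other. -/
theorem sum_mul_sum_eq_sum_mulLin_mul {k : Type*} [Field k] {n d : ℕ} (a : Fin n → k)
    (f φ : (Fin n → ℕ) → k) :
    ∑ m ∈ Finset.Nat.antidiagonalTuple n d,
        f m * ∑ i, a i * φ (m + (Pi.single i 1 : Fin n → ℕ)) =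
      ∑ m ∈ Finset.Nat.antidiagonalTuple n (d + 1), mulLin a f m * φ m := by
  simp only [mulLin_apply, Finset.mul_sum, Finset.sum_mul]
  rw [Finset.sum_comm, Finset.sum_comm (s := Finset.Nat.antidiagonalTuple n (d + 1))]
  refine Finset.sum_congr rfl fun i _ => ?_
  have h : ∀ m : Fin n → ℕ, (if m i = 0 then 0 else a i * f (m - Pi.single i 1)) * φ m =
      if m i ≠ 0 then a i * f (m - Pi.single i 1) * φ m else 0 := by
    intro m; by_cases h : m i = 0 <;> simp [h]
  simp only [h]
  rw [← Finset.sum_filter]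
  refine Finset.sum_bij' (fun m _ => m + (Pi.single i 1 : Fin n → ℕ))
    (fun m _ => m - (Pi.single i 1 : Fin n → ℕ)) ?_ ?_ ?_ ?_ ?_
  · intro m hm
    rw [Finset.Nat.mem_antidiagonalTuple] at hm
    rw [Finset.mem_filter, Finset.Nat.mem_antidiagonalTuple, sum_add_single, hm]
    simp
  · intro m hm
    rw [Finset.mem_filter, Finset.Nat.mem_antidiagonalTuple] at hm
    have := sum_add_single (m - (Pi.single i 1 : Fin n → ℕ)) i
    rw [sub_single_add_single hm.2, hm.1] at this
    rw [Finset.Nat.mem_antidiagonalTuple]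
    omega
  · intro m _; simp
  · intro m hm
    exact sub_single_add_single (Finset.mem_filter.1 hm).2
  · intro m _
    simp only [add_tsub_cancel_right]
    ring

/-- If multiplication by a linear form from degree `d` to degree `d + 1` kills a form and the
dimension does not drop, then it is not surjective. -/
theorem FailsInjectivity.failsSurjectivity {k : Type*} [Field k] {n d : ℕ} {a : Fin n → k}
    {T : Finset (Fin n → ℕ)} (h : FailsInjectivity a T d) (hT : ∀ t ∈ T, ∑ i, t i = d + 1)
    (hcard : (Finset.Nat.antidiagonalTuple n d).card + T.card ≤
      (Finset.Nat.antidiagonalTuple n (d + 1)).card) :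
    FailsSurjectivity a T (d + 1) := by
  obtain ⟨f, hfd, ⟨m₀, hm₀, hm₀T⟩, hf⟩ := h
  let A := Finset.Nat.antidiagonalTuple n d
  let B := Finset.Nat.antidiagonalTuple n (d + 1) \ T
  let ext : (B → k) → (Fin n → ℕ) → k := fun φ m => if h : m ∈ B then φ ⟨m, h⟩ else 0
  have hext : ∀ φ m, ext φ m ≠ 0 → m ∈ B := by
    intro φ m hm
    by_contra h0
    exact hm (dif_neg h0)
  let N : (B → k) →ₗ[k] (A → k) :=
    { toFun := fun φ m => ∑ i, a i * ext φ (m.1 + (Pi.single i 1 : Fin n → ℕ))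
      map_add' := by
        intro φ ψ
        funext m
        simp only [Pi.add_apply, ← Finset.sum_add_distrib]
        refine Finset.sum_congr rfl fun i _ => ?_
        simp only [ext]
        split_ifs <;> simp [mul_add]
      map_smul' := by
        intro c φ
        funext m
        simp only [Pi.smul_apply, smul_eq_mul, RingHom.id_apply, Finset.mul_sum]
        refine Finset.sum_congr rfl fun i _ => ?_
        simp only [ext]
        split_ifs <;> simp [mul_left_comm] }
  -- If `N` were injective, it would be bijective; but its image is orthogonal to `f`.
  have hN : ¬ Function.Injective N := by
    intro hinj
    have hB : (Finset.Nat.antidiagonalTuple n (d + 1)).card ≤ B.card + T.card :=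
      Finset.card_le_card_sdiff_add_card
    have hfin : Module.finrank k (B → k) = Module.finrank k (A → k) := by
      refine le_antisymm (LinearMap.finrank_le_finrank_of_injective hinj) ?_
      simp only [Module.finrank_fintype_fun_eq_card, Fintype.card_coe]
      change (Finset.Nat.antidiagonalTuple n d).card ≤ _
      omega
    have hsurj := (LinearMap.injective_iff_surjective_of_finrank_eq_finrank hfin).1 hinj
    have hm₀A : m₀ ∈ A := Finset.Nat.mem_antidiagonalTuple.2 (hfd m₀ hm₀)
    obtain ⟨φ, hφ⟩ := hsurj (Pi.single ⟨m₀, hm₀A⟩ 1)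
    have hsum := sum_mul_sum_eq_sum_mulLin_mul (d := d) a f (ext φ)
    rw [Finset.sum_eq_zero (s := Finset.Nat.antidiagonalTuple n (d + 1))] at hsum
    · rw [Finset.sum_eq_single_of_mem m₀ hm₀A] at hsum
      · have := congrFun hφ ⟨m₀, hm₀A⟩
        rw [Pi.single_eq_same] at this
        change ∑ i, a i * ext φ (m₀ + (Pi.single i 1 : Fin n → ℕ)) = 1 at this
        rw [this, mul_one] at hsum
        exact hm₀ hsum
      · intro m hm hne
        have := congrFun hφ ⟨m, hm⟩
        rw [Pi.single_eq_of_ne (by simpa using hne)] at this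
        exact mul_eq_zero_of_right _ this
    · intro m hm
      by_cases h0 : ext φ m = 0
      · rw [h0, mul_zero]
      · have h1 := Finset.mem_sdiff.1 (hext φ m h0)
        rw [hf m, zero_mul]
        rw [isMultipleOf_iff_mem hT (Finset.Nat.mem_antidiagonalTuple.1 hm)]
        exact h1.2
  rw [← LinearMap.ker_eq_bot, Submodule.eq_bot_iff] at hN
  push Not at hN
  obtain ⟨φ, hφ, hφ0⟩ := hN
  refine ⟨ext φ, fun m hm => ?_, ?_, fun m => ?_⟩
  · have h1 := Finset.mem_sdiff.1 (hext φ m hm)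
    have h2 := Finset.Nat.mem_antidiagonalTuple.1 h1.1
    exact ⟨h2, by rw [isMultipleOf_iff_mem hT h2]; exact h1.2⟩
  · obtain ⟨m, hm⟩ := Function.ne_iff.1 hφ0
    refine ⟨m.1, ?_⟩
    simpa [ext] using hm
  · by_cases hm : m ∈ A
    · exact congrFun hφ ⟨m, hm⟩
    · refine Finset.sum_eq_zero fun i _ => mul_eq_zero_of_right _ ?_
      by_contra h0
      have h1 := Finset.Nat.mem_antidiagonalTuple.1 (Finset.mem_sdiff.1 (hext φ _ h0)).1
      rw [sum_add_single] at h1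
      exact hm (Finset.Nat.mem_antidiagonalTuple.2 (by omega))

theorem card_antidiagonalTuple_add_le {n d c : ℕ} (hn : n ≠ 0)
    (hc : c ≤ (n + d - 1).choose (d + 1)) :
    (Finset.Nat.antidiagonalTuple n d).card + c ≤
      (Finset.Nat.antidiagonalTuple n (d + 1)).card := by
  obtain ⟨n, rfl⟩ := Nat.exists_eq_succ_of_ne_zero hn
  rw [card_antidiagonalTuple, card_antidiagonalTuple]
  have h1 : n.succ + (d + 1) - 1 = (n + d) + 1 := by omega
  have h2 : n.succ + d - 1 = n + d := by omega
  rw [h2] at hc ⊢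
  rw [h1, Nat.choose_succ_succ']
  omega

/-! ### Disjoint sets of variables -/

/-- The generators `T₁` and `T₂` in disjoint sets of variables, put together. -/
noncomputable def joinGenerators {n n' : ℕ} (T₁ : Finset (Fin n → ℕ)) (T₂ : Finset (Fin n' → ℕ)) :
    Finset (Fin (n + n') → ℕ) :=
  T₁.image (fun m => Fin.append m 0) ∪ T₂.image (fun m => Fin.append 0 m)

theorem isMultipleOf_joinGenerators {n n' : ℕ} {T₁ : Finset (Fin n → ℕ)}
    {T₂ : Finset (Fin n' → ℕ)} {m : Fin (n + n') → ℕ} :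
    IsMultipleOf (joinGenerators T₁ T₂) m ↔
      IsMultipleOf T₁ (fun i => m (Fin.castAdd n' i)) ∨
        IsMultipleOf T₂ (fun i => m (Fin.natAdd n i)) := by
  constructor
  · rintro ⟨t, ht, hle⟩
    rw [joinGenerators, Finset.mem_union, Finset.mem_image, Finset.mem_image] at ht
    rcases ht with ⟨s, hs, rfl⟩ | ⟨s, hs, rfl⟩
    · exact Or.inl ⟨s, hs, fun i => by simpa using hle (Fin.castAdd n' i)⟩
    · exact Or.inr ⟨s, hs, fun i => by simpa using hle (Fin.natAdd n i)⟩
  · rintro (⟨s, hs, hle⟩ | ⟨s, hs, hle⟩)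
    · refine ⟨Fin.append s 0, by
        rw [joinGenerators, Finset.mem_union]; exact Or.inl (Finset.mem_image_of_mem _ hs), ?_⟩
      intro i
      refine Fin.addCases (fun i => ?_) (fun i => ?_) i
      · simpa using hle i
      · simp
    · refine ⟨Fin.append 0 s, by
        rw [joinGenerators, Finset.mem_union]; exact Or.inr (Finset.mem_image_of_mem _ hs), ?_⟩
      intro i
      refine Fin.addCases (fun i => ?_) (fun i => ?_) i
      · simp
      · simpa using hle i

theorem sum_of_mem_joinGenerators {n n' d : ℕ} {T₁ : Finset (Fin n → ℕ)}
    {T₂ : Finset (Fin n' → ℕ)} (h₁ : ∀ t ∈ T₁, ∑ i, t i = d) (h₂ : ∀ t ∈ T₂, ∑ i, t i = d) :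
    ∀ t ∈ joinGenerators T₁ T₂, ∑ i, t i = d := by
  intro t ht
  rw [joinGenerators, Finset.mem_union, Finset.mem_image, Finset.mem_image] at ht
  rcases ht with ⟨s, hs, rfl⟩ | ⟨s, hs, rfl⟩
  · simpa [Fin.sum_univ_add] using h₁ s hs
  · simpa [Fin.sum_univ_add] using h₂ s hs

theorem card_joinGenerators {n n' d : ℕ} (hd : d ≠ 0) {T₁ : Finset (Fin n → ℕ)}
    {T₂ : Finset (Fin n' → ℕ)} (h₁ : ∀ t ∈ T₁, ∑ i, t i = d) :
    (joinGenerators T₁ T₂).card = T₁.card + T₂.card := by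
  rw [joinGenerators, Finset.card_union_of_disjoint, Finset.card_image_of_injective,
    Finset.card_image_of_injective]
  · intro s t h
    funext i
    simpa using congrFun h (Fin.natAdd n i)
  · intro s t h
    funext i
    simpa using congrFun h (Fin.castAdd n' i)
  · rw [Finset.disjoint_left]
    intro m hm hm'
    obtain ⟨s, hs, rfl⟩ := Finset.mem_image.1 hm
    obtain ⟨t, -, h⟩ := Finset.mem_image.1 hm'
    refine hd ?_
    rw [← h₁ s hs]
    refine Finset.sum_eq_zero fun i _ => ?_
    simpa using (congrFun h (Fin.castAdd n' i)).symm

theorem single_mem_joinGenerators {n n' d : ℕ} {T₁ : Finset (Fin n → ℕ)}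
    {T₂ : Finset (Fin n' → ℕ)} (h₁ : ∀ i, Pi.single i d ∈ T₁) (h₂ : ∀ i, Pi.single i d ∈ T₂)
    (i : Fin (n + n')) : Pi.single i d ∈ joinGenerators T₁ T₂ := by
  rw [joinGenerators, Finset.mem_union, Finset.mem_image, Finset.mem_image]
  refine Fin.addCases (fun i => ?_) (fun i => ?_) i
  · refine Or.inl ⟨_, h₁ i, funext fun l => ?_⟩
    refine Fin.addCases (fun l => ?_) (fun l => ?_) l
    · simp [Pi.single_apply]
    · rw [Fin.append_right, Pi.single_eq_of_ne]
      · rfl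
      · simp [Fin.ext_iff]; omega
  · refine Or.inr ⟨_, h₂ i, funext fun l => ?_⟩
    refine Fin.addCases (fun l => ?_) (fun l => ?_) l
    · rw [Fin.append_left, Pi.single_eq_of_ne]
      · rfl
      · simp [Fin.ext_iff]; omega
    · simp [Pi.single_apply]

/-- The coefficients of the product of forms in disjoint sets of variables. -/
def tensor {k : Type*} [Field k] {n n' : ℕ} (f : (Fin n → ℕ) → k) (g : (Fin n' → ℕ) → k)
    (m : Fin (n + n') → ℕ) : k :=
  f (fun i => m (Fin.castAdd n' i)) * g (fun i => m (Fin.natAdd n i))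

theorem single_castAdd_comp_castAdd {n n' : ℕ} (i : Fin n) :
    (fun l => (Pi.single (Fin.castAdd n' i) 1 : Fin (n + n') → ℕ) (Fin.castAdd n' l)) =
      Pi.single i 1 := by
  funext l; simp [Pi.single_apply]

theorem single_castAdd_comp_natAdd {n n' : ℕ} (i : Fin n) :
    (fun l => (Pi.single (Fin.castAdd n' i) 1 : Fin (n + n') → ℕ) (Fin.natAdd n l)) = 0 := by
  funext l
  rw [Pi.single_eq_of_ne, Pi.zero_apply]
  simp [Fin.ext_iff]; omega

theorem single_natAdd_comp_castAdd {n n' : ℕ} (i : Fin n') :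
    (fun l => (Pi.single (Fin.natAdd n i) 1 : Fin (n + n') → ℕ) (Fin.castAdd n' l)) = 0 := by
  funext l
  rw [Pi.single_eq_of_ne, Pi.zero_apply]
  simp [Fin.ext_iff]; omega

theorem single_natAdd_comp_natAdd {n n' : ℕ} (i : Fin n') :
    (fun l => (Pi.single (Fin.natAdd n i) 1 : Fin (n + n') → ℕ) (Fin.natAdd n l)) =
      Pi.single i 1 := by
  funext l; simp [Pi.single_apply]

/-- Leibniz rule: a linear form on `n + n'` variables is the sum of its two parts. -/
theorem mulLin_tensor {k : Type*} [Field k] {n n' : ℕ} (a : Fin (n + n') → k)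
    (f : (Fin n → ℕ) → k) (g : (Fin n' → ℕ) → k) (m : Fin (n + n') → ℕ) :
    mulLin a (tensor f g) m =
      tensor (mulLin (fun i => a (Fin.castAdd n' i)) f) g m +
        tensor f (mulLin (fun i => a (Fin.natAdd n i)) g) m := by
  rw [mulLin_apply, Fin.sum_univ_add]
  simp only [tensor, mulLin_apply, Finset.sum_mul, Finset.mul_sum, Pi.sub_apply]
  congr 1
  · refine Finset.sum_congr rfl fun i _ => ?_
    have h1 := single_castAdd_comp_castAdd (n' := n') i
    have h2 := single_castAdd_comp_natAdd (n' := n') i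
    have h3 : (fun l => m (Fin.castAdd n' l) -
        (Pi.single (Fin.castAdd n' i) 1 : Fin (n + n') → ℕ) (Fin.castAdd n' l)) =
        (fun l => m (Fin.castAdd n' l)) - Pi.single i 1 := by
      rw [← h1]; rfl
    have h4 : (fun l => m (Fin.natAdd n l) -
        (Pi.single (Fin.castAdd n' i) 1 : Fin (n + n') → ℕ) (Fin.natAdd n l)) =
        (fun l => m (Fin.natAdd n l)) := by
      funext l; rw [congrFun h2 l]; rfl
    rw [h3, h4]
    split_ifs <;> ring
  · refine Finset.sum_congr rfl fun i _ => ?_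
    have h1 := single_natAdd_comp_natAdd (n := n) i
    have h2 := single_natAdd_comp_castAdd (n := n) i
    have h3 : (fun l => m (Fin.natAdd n l) -
        (Pi.single (Fin.natAdd n i) 1 : Fin (n + n') → ℕ) (Fin.natAdd n l)) =
        (fun l => m (Fin.natAdd n l)) - Pi.single i 1 := by
      rw [← h1]; rfl
    have h4 : (fun l => m (Fin.castAdd n' l) -
        (Pi.single (Fin.natAdd n i) 1 : Fin (n + n') → ℕ) (Fin.castAdd n' l)) =
        (fun l => m (Fin.castAdd n' l)) := by
      funext l; rw [congrFun h2 l]; rfl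
    rw [h3, h4]
    split_ifs <;> ring

theorem tensor_append {k : Type*} [Field k] {n n' : ℕ} (f : (Fin n → ℕ) → k)
    (g : (Fin n' → ℕ) → k) (m : Fin n → ℕ) (m' : Fin n' → ℕ) :
    tensor f g (Fin.append m m') = f m * g m' := by
  simp [tensor]

theorem isMultipleOf_joinGenerators_append {n n' : ℕ} {T₁ : Finset (Fin n → ℕ)}
    {T₂ : Finset (Fin n' → ℕ)} {m : Fin n → ℕ} {m' : Fin n' → ℕ} :
    IsMultipleOf (joinGenerators T₁ T₂) (Fin.append m m') ↔
      IsMultipleOf T₁ m ∨ IsMultipleOf T₂ m' := by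
  simp [isMultipleOf_joinGenerators]

theorem sum_of_tensor_ne_zero {k : Type*} [Field k] {n n' j j' : ℕ} {f : (Fin n → ℕ) → k}
    {g : (Fin n' → ℕ) → k} (hf : ∀ m, f m ≠ 0 → ∑ i, m i = j)
    (hg : ∀ m, g m ≠ 0 → ∑ i, m i = j') (m : Fin (n + n') → ℕ) (hm : tensor f g m ≠ 0) :
    ∑ i, m i = j + j' := by
  rw [Fin.sum_univ_add, hf _ (left_ne_zero_of_mul hm), hg _ (right_ne_zero_of_mul hm)]

theorem FailsInjectivity.join {k : Type*} [Field k] {n n' j j' : ℕ} {a : Fin (n + n') → k}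
    {T₁ : Finset (Fin n → ℕ)} {T₂ : Finset (Fin n' → ℕ)}
    (h₁ : FailsInjectivity (fun i => a (Fin.castAdd n' i)) T₁ j)
    (h₂ : FailsInjectivity (fun i => a (Fin.natAdd n i)) T₂ j') :
    FailsInjectivity a (joinGenerators T₁ T₂) (j + j') := by
  obtain ⟨f, hfj, ⟨m, hm, hmT⟩, hf⟩ := h₁
  obtain ⟨g, hgj, ⟨m', hm', hmT'⟩, hg⟩ := h₂
  refine ⟨tensor f g, sum_of_tensor_ne_zero hfj hgj, ⟨Fin.append m m', ?_, ?_⟩, ?_⟩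
  · rw [tensor_append]; exact mul_ne_zero hm hm'
  · rw [isMultipleOf_joinGenerators_append]; tauto
  · intro m hm
    rw [isMultipleOf_joinGenerators, not_or] at hm
    rw [mulLin_tensor, tensor, tensor, hf _ hm.1, hg _ hm.2, zero_mul, mul_zero, add_zero]

theorem FailsSurjectivity.join {k : Type*} [Field k] {n n' j j' : ℕ} {a : Fin (n + n') → k}
    {T₁ : Finset (Fin n → ℕ)} {T₂ : Finset (Fin n' → ℕ)}
    (h₁ : FailsSurjectivity (fun i => a (Fin.castAdd n' i)) T₁ j)
    (h₂ : FailsSurjectivity (fun i => a (Fin.natAdd n i)) T₂ j') :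
    FailsSurjectivity a (joinGenerators T₁ T₂) (j + j') := by
  obtain ⟨φ, hφj, ⟨m, hm⟩, hφ⟩ := h₁
  obtain ⟨ψ, hψj, ⟨m', hm'⟩, hψ⟩ := h₂
  refine ⟨tensor φ ψ, fun m hm => ⟨?_, ?_⟩, ⟨Fin.append m m', ?_⟩, ?_⟩
  · exact sum_of_tensor_ne_zero (fun m hm => (hφj m hm).1) (fun m hm => (hψj m hm).1) m hm
  · rw [isMultipleOf_joinGenerators, not_or]
    exact ⟨(hφj _ (left_ne_zero_of_mul hm)).2, (hψj _ (right_ne_zero_of_mul hm)).2⟩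
  · rw [tensor_append]; exact mul_ne_zero hm hm'
  · intro m
    rw [Fin.sum_univ_add]
    simp only [tensor, Pi.add_apply]
    have h1 := hφ fun i => m (Fin.castAdd n' i)
    have h2 := hψ fun i => m (Fin.natAdd n i)
    have e1 : ∀ i : Fin n, (fun l => m (Fin.castAdd n' l) +
        (Pi.single (Fin.castAdd n' i) 1 : Fin (n + n') → ℕ) (Fin.castAdd n' l)) =
        (fun l => m (Fin.castAdd n' l)) + Pi.single i 1 := by
      intro i; rw [← single_castAdd_comp_castAdd (n' := n') i]; rfl
    have e2 : ∀ i : Fin n, (fun l => m (Fin.natAdd n l) +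
        (Pi.single (Fin.castAdd n' i) 1 : Fin (n + n') → ℕ) (Fin.natAdd n l)) =
        (fun l => m (Fin.natAdd n l)) := by
      intro i; funext l; rw [congrFun (single_castAdd_comp_natAdd (n' := n') i) l]; rfl
    have e3 : ∀ i : Fin n', (fun l => m (Fin.natAdd n l) +
        (Pi.single (Fin.natAdd n i) 1 : Fin (n + n') → ℕ) (Fin.natAdd n l)) =
        (fun l => m (Fin.natAdd n l)) + Pi.single i 1 := by
      intro i; rw [← single_natAdd_comp_natAdd (n := n) i]; rfl
    have e4 : ∀ i : Fin n', (fun l => m (Fin.castAdd n' l) +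
        (Pi.single (Fin.natAdd n i) 1 : Fin (n + n') → ℕ) (Fin.castAdd n' l)) =
        (fun l => m (Fin.castAdd n' l)) := by
      intro i; funext l; rw [congrFun (single_natAdd_comp_castAdd (n := n) i) l]; rfl
    simp only [e1, e2, e3, e4]
    have s1 : ∀ x : k, ∑ i, a (Fin.castAdd n' i) *
        (φ ((fun l => m (Fin.castAdd n' l)) + Pi.single i 1) * x) = 0 := by
      intro x
      simp only [← mul_assoc, ← Finset.sum_mul, h1, zero_mul]
    have s2 : ∀ x : k, ∑ i, a (Fin.natAdd n i) *
        (x * ψ ((fun l => m (Fin.natAdd n l)) + Pi.single i 1)) = 0 := by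
      intro x
      simp only [mul_left_comm _ x, ← Finset.mul_sum, h2, mul_zero]
    rw [s1, s2, add_zero]

/-! ### Blocks of two variables -/

theorem sum_of_mulLin_pow_ne_zero {k : Type*} [Field k] {n : ℕ} {a : Fin n → k}
    {f : (Fin n → ℕ) → k} {j : ℕ} (hf : ∀ m, f m ≠ 0 → ∑ i, m i = j) (r : ℕ) {m : Fin n → ℕ}
    (hm : (mulLin a ^ r) f m ≠ 0) : ∑ i, m i = j + r := by
  induction r generalizing m with
  | zero => exact hf m hm
  | succ r ih =>
    rw [pow_succ', Module.End.mul_apply] at hm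
    exact sum_of_mulLin_ne_zero (fun m hm => ih hm) hm

/-- Multiplication by a nonzero linear form is injective, since polynomial rings are domains. -/
theorem exists_mulLin_ne_zero {k : Type*} [Field k] {n : ℕ} {a : Fin n → k} (ha : a ≠ 0)
    {f : (Fin n → ℕ) → k} {j : ℕ} (hf : ∀ m, f m ≠ 0 → ∑ i, m i = j) (hf0 : ∃ m, f m ≠ 0) :
    ∃ m, mulLin a f m ≠ 0 := by
  by_contra! hc
  have hzero : (∑ i, MvPolynomial.C (a i) * MvPolynomial.X i) * formOfCoeffs j f = 0 := by
    ext m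
    obtain ⟨m, rfl⟩ := Finsupp.equivFunOnFinite.symm.surjective m
    rw [coeff_linearForm_mul]
    simpa only [coeff_formOfCoeffs hf, MvPolynomial.coeff_zero] using hc m
  rcases mul_eq_zero.1 hzero with h | h
  · refine ha (funext fun i => ?_)
    have := congrArg (MvPolynomial.coeff (Finsupp.single i 1)) h
    simpa [MvPolynomial.coeff_sum, MvPolynomial.coeff_C_mul, MvPolynomial.coeff_X,
      Finsupp.single_left_inj] using this
  · obtain ⟨m, hm⟩ := hf0
    rw [← coeff_formOfCoeffs hf, h] at hm
    exact hm (MvPolynomial.coeff_zero _)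

/-- The `N + 1` coefficients of a binary form `b` of degree `N` can be chosen so that `N`
prescribed coefficients of the product of `b` with a power of a linear form vanish. -/
theorem exists_binaryForm {k : Type*} [Field k] (a : Fin 2 → k) (N r s : ℕ) :
    ∃ b : (Fin 2 → ℕ) → k, (∀ m, b m ≠ 0 → ∑ i, m i = N) ∧ (∃ m, b m ≠ 0) ∧
      ∀ m, s ≤ m 0 → m 0 < s + N → (mulLin a ^ r) b m = 0 := by
  let B : (Fin (N + 1) → k) →ₗ[k] (Fin 2 → ℕ) → k :=
    { toFun := fun β m => if h : m 0 + m 1 = N then β ⟨m 0, by omega⟩ else 0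
      map_add' := by intro β γ; funext m; dsimp only [Pi.add_apply]; split_ifs <;> simp
      map_smul' := by
        intro c β; funext m
        dsimp only [Pi.smul_apply, RingHom.id_apply]; split_ifs <;> simp }
  have hB : ∀ β m, B β m ≠ 0 → ∑ i, m i = N := by
    intro β m hm
    rw [Fin.sum_univ_two]
    by_contra h
    exact hm (dif_neg h)
  let M : (Fin (N + 1) → k) →ₗ[k] (Fin N → k) :=
    { toFun := fun β p => (mulLin a ^ r) (B β) ![s + p, N + r - (s + p)]
      map_add' := by intro β γ; funext p; simp only [map_add, Pi.add_apply]
      map_smul' := by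
        intro c β; funext p; simp only [map_smul, Pi.smul_apply, RingHom.id_apply] }
  have hM : M.ker ≠ ⊥ := LinearMap.ker_ne_bot_of_finrank_lt (by simp)
  obtain ⟨β, hβ, hβ0⟩ := (Submodule.ne_bot_iff _).1 hM
  refine ⟨B β, hB β, ?_, fun m hm hm' => ?_⟩
  · obtain ⟨p, hp⟩ := Function.ne_iff.1 hβ0
    refine ⟨![p, N - p], ?_⟩
    have : (p : ℕ) + (N - p) = N := by omega
    simpa [B, this] using hp
  · by_contra h
    have hdeg := sum_of_mulLin_pow_ne_zero (hB β) r h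
    rw [Fin.sum_univ_two] at hdeg
    have := congrFun hβ ⟨m 0 - s, by omega⟩
    refine h ?_
    change (mulLin a ^ r) (B β) ![s + (m 0 - s), N + r - (s + (m 0 - s))] = 0 at this
    rw [← this]
    refine congrArg _ (funext fun i => ?_)
    fin_cases i
    · simp; omega
    · simp; omega

theorem isMultipleOf_of_le {n d : ℕ} {T : Finset (Fin n → ℕ)} {i : Fin n}
    (h : Pi.single i d ∈ T) {m : Fin n → ℕ} (hm : d ≤ m i) : IsMultipleOf T m := by
  refine ⟨_, h, fun l => ?_⟩
  by_cases hl : l = i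
  · subst hl; simpa using hm
  · simp [hl]

/-- Over `k[x, y]`, multiplication by a linear form kills a form of degree `e` modulo
`x ^ (e + 1)` and `y ^ (e + 1)`. -/
theorem failsInjectivity_pair {k : Type*} [Field k] (a : Fin 2 → k) {e : ℕ}
    {T : Finset (Fin 2 → ℕ)} (hT : ∀ t ∈ T, ∑ i, t i = e + 1)
    (hpow : ∀ i, Pi.single i (e + 1) ∈ T) : FailsInjectivity a T e := by
  obtain ⟨b, hb, ⟨m₀, hm₀⟩, hb'⟩ := exists_binaryForm a e 1 1
  refine ⟨b, hb, ⟨m₀, hm₀, not_isMultipleOf_of_lt hT (by rw [hb m₀ hm₀]; omega)⟩, ?_⟩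
  intro m hm
  by_contra h0
  have hdeg := sum_of_mulLin_ne_zero hb h0
  rw [Fin.sum_univ_two] at hdeg
  have h1 : m 0 < e + 1 := not_le.1 fun h => hm (isMultipleOf_of_le (hpow 0) h)
  have h2 : m 1 < e + 1 := not_le.1 fun h => hm (isMultipleOf_of_le (hpow 1) h)
  have := hb' m (by omega) (by omega)
  rw [pow_one] at this
  exact h0 this

/-- The functional on the forms of degree `e` in `x, y` with values
`x ^ p * y ^ q ↦ a 1 ^ p * (-a 0) ^ q` vanishes on the multiples of `a 0 * x + a 1 * y`. -/
theorem failsSurjectivity_pair {k : Type*} [Field k] (a : Fin 2 → k) {e : ℕ}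
    {T : Finset (Fin 2 → ℕ)} (hT : ∀ t ∈ T, ∑ i, t i = e + 1) : FailsSurjectivity a T e := by
  by_cases ha : a = 0
  · refine ⟨fun m => if m = Pi.single 0 e then 1 else 0, fun m hm => ?_,
      ⟨Pi.single 0 e, by simp⟩, fun m => by simp [ha]⟩
    have : m = Pi.single 0 e := by
      by_contra h; simp [h] at hm
    subst this
    exact ⟨by simp, not_isMultipleOf_of_lt hT (by simp)⟩
  · refine ⟨fun m => if m 0 + m 1 = e then a 1 ^ m 0 * (-a 0) ^ m 1 else 0, fun m hm => ?_, ?_,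
      fun m => ?_⟩
    · have : m 0 + m 1 = e := by
        by_contra h; simp [h] at hm
      have h2 : ∑ i, m i = e := by rw [Fin.sum_univ_two, this]
      exact ⟨h2, not_isMultipleOf_of_lt hT (by omega)⟩
    · by_cases h0 : a 0 = 0
      · have h1 : a 1 ≠ 0 := by
          intro h1
          refine ha (funext fun i => ?_)
          fin_cases i <;> simp [h0, h1]
        exact ⟨![e, 0], by simp [h1]⟩
      · exact ⟨![0, e], by simp [h0]⟩
    · rw [Fin.sum_univ_two]
      simp only [Pi.add_apply, Pi.single_eq_same, ne_eq, zero_ne_one, one_ne_zero,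
        not_false_eq_true, Pi.single_eq_of_ne, add_zero]
      by_cases h : m 0 + m 1 + 1 = e
      · rw [if_pos (by omega), if_pos (by omega)]
        ring
      · rw [if_neg (by omega), if_neg (by omega)]
        simp

/-- The monomials `x ^ d, y ^ d, x ^ (d - 1) * y, x * y ^ (d - 1)`. -/
def outerPair (d : ℕ) : Finset (Fin 2 → ℕ) := {![d, 0], ![0, d], ![d - 1, 1], ![1, d - 1]}

theorem single_zero_eq (d : ℕ) : (Pi.single 0 d : Fin 2 → ℕ) = ![d, 0] := by
  funext i; fin_cases i <;> simp

theorem single_one_eq (d : ℕ) : (Pi.single 1 d : Fin 2 → ℕ) = ![0, d] := by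
  funext i; fin_cases i <;> simp

theorem card_outerPair {d : ℕ} (hd : 3 ≤ d) : (outerPair d).card = 4 := by
  rw [outerPair, Finset.card_insert_of_notMem, Finset.card_insert_of_notMem,
    Finset.card_insert_of_notMem, Finset.card_singleton]
  all_goals simp [funext_iff, Fin.forall_fin_two]; try omega

theorem sum_of_mem_outerPair {d : ℕ} (hd : 3 ≤ d) : ∀ t ∈ outerPair d, ∑ i, t i = d := by
  intro t ht
  simp only [outerPair, Finset.mem_insert, Finset.mem_singleton] at ht
  rcases ht with rfl | rfl | rfl | rfl <;> simp <;> omega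

theorem single_mem_outerPair (d : ℕ) (i : Fin 2) : Pi.single i d ∈ outerPair d := by
  fin_cases i
  · simp [outerPair, single_zero_eq]
  · simp [outerPair, single_one_eq]

theorem exists_pairGenerators {d r : ℕ} (hd : 3 ≤ d) (hr : r ≤ 2) :
    ∃ T : Finset (Fin 2 → ℕ), (∀ t ∈ T, ∑ i, t i = d) ∧ (∀ i, Pi.single i d ∈ T) ∧
      T.card = 2 + r := by
  have hsub : Finset.univ.image (fun i : Fin 2 => (Pi.single i d : Fin 2 → ℕ)) ⊆ outerPair d := by
    intro t ht
    obtain ⟨i, -, rfl⟩ := Finset.mem_image.1 ht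
    exact single_mem_outerPair d i
  obtain ⟨T, h1, h2, h3⟩ := Finset.exists_subsuperset_card_eq (n := 2 + r) hsub
    (Finset.card_image_le.trans (by simp)) (by rw [card_outerPair hd]; omega)
  exact ⟨T, fun t ht => sum_of_mem_outerPair hd t (h2 ht),
    fun i => h1 (Finset.mem_image_of_mem _ (Finset.mem_univ i)), h3⟩

/-! ### Four variables -/

/-- Let `u` and `v` be the parts of a linear form in the two blocks of variables. If `u ≠ 0`, take
forms `b` of degree `d - 3` and `c` of degree `d - 2` with `u ^ 3 * b` and `v ^ 3 * c` in the ideal.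
Then `(u + v) * (u ^ 2 - u * v + v ^ 2) = u ^ 3 + v ^ 3` shows that `u + v` kills
`b * c * (u ^ 2 - u * v + v ^ 2)`. -/
theorem failsInjectivity_outerPair_join {k : Type*} [Field k] {e : ℕ} (a : Fin (2 + 2) → k)
    {T : Finset (Fin 2 → ℕ)} (hT : ∀ t ∈ T, ∑ i, t i = e + 3)
    (hpow : ∀ i, Pi.single i (e + 3) ∈ T) :
    FailsInjectivity a (joinGenerators (outerPair (e + 3)) T) ((e + 1) + (e + 2)) := by
  have hO : ∀ t ∈ outerPair (e + 3), ∑ i, t i = e + 3 := sum_of_mem_outerPair (by omega)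
  by_cases hu : (fun i => a (Fin.castAdd 2 i)) = 0
  · -- If `u = 0`, multiply `x ^ (d - 2)` by a form of degree `d - 1` that `v` kills.
    refine FailsInjectivity.join ?_ (failsInjectivity_pair _ hT hpow)
    rw [hu]
    refine ⟨fun m => if m = Pi.single 0 (e + 1) then 1 else 0, fun m hm => ?_,
      ⟨Pi.single 0 (e + 1), by simp, not_isMultipleOf_of_lt hO (by simp)⟩,
      fun m _ => by simp [mulLin_apply]⟩
    have : m = Pi.single 0 (e + 1) := by
      by_contra h; simp [h] at hm
    simp [this]
  set u : Fin 2 → k := fun i => a (Fin.castAdd 2 i) with hu_def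
  set v : Fin 2 → k := fun i => a (Fin.natAdd 2 i) with hv_def
  obtain ⟨b, hb, hb0, hb'⟩ := exists_binaryForm u e 3 2
  obtain ⟨c, hc, ⟨m', hm'⟩, hc'⟩ := exists_binaryForm v (e + 1) 3 2
  have hu1 : ∃ m, mulLin u b m ≠ 0 := exists_mulLin_ne_zero hu hb hb0
  have hdu1 : ∀ m, mulLin u b m ≠ 0 → ∑ i, m i = e + 1 := fun m hm =>
    sum_of_mulLin_ne_zero hb hm
  obtain ⟨m, hm⟩ := exists_mulLin_ne_zero hu hdu1 hu1
  have hdu2 : ∀ m, mulLin u (mulLin u b) m ≠ 0 → ∑ i, m i = e + 2 := fun m hm =>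
    sum_of_mulLin_ne_zero hdu1 hm
  have hdv1 : ∀ m, mulLin v c m ≠ 0 → ∑ i, m i = e + 2 := fun m hm =>
    sum_of_mulLin_ne_zero hc hm
  have hdv2 : ∀ m, mulLin v (mulLin v c) m ≠ 0 → ∑ i, m i = e + 3 := fun m hm =>
    sum_of_mulLin_ne_zero hdv1 hm
  have hu3 : ∀ m, ¬ IsMultipleOf (outerPair (e + 3)) m →
      mulLin u (mulLin u (mulLin u b)) m = 0 := by
    intro m hmT
    by_contra h0
    have hdeg : ∑ i, m i = e + 3 := sum_of_mulLin_ne_zero hdu2 h0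
    rw [isMultipleOf_iff_mem hO hdeg] at hmT
    rw [Fin.sum_univ_two] at hdeg
    have hne : ∀ p q, m 0 = p → m 1 = q → ![p, q] ∉ outerPair (e + 3) := by
      rintro p q rfl rfl h
      refine hmT ?_
      have : m = ![m 0, m 1] := by funext i; fin_cases i <;> rfl
      rwa [this]
    refine h0 (hb' m ?_ ?_)
    · by_contra h
      have h01 : m 0 = 0 ∨ m 0 = 1 := by omega
      rcases h01 with h | h
      · exact hne 0 (e + 3) h (by omega) (by simp [outerPair])
      · exact hne 1 (e + 2) h (by omega) (by simp [outerPair])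
    · by_contra h
      have h01 : m 1 = 0 ∨ m 1 = 1 := by omega
      rcases h01 with h | h
      · exact hne (e + 3) 0 (by omega) h (by simp [outerPair])
      · exact hne (e + 2) 1 (by omega) h (by simp [outerPair])
  have hv3 : ∀ m, ¬ IsMultipleOf T m → mulLin v (mulLin v (mulLin v c)) m = 0 := by
    intro m hmT
    by_contra h0
    have hdeg : ∑ i, m i = e + 4 := sum_of_mulLin_ne_zero hdv2 h0
    rw [Fin.sum_univ_two] at hdeg
    have h1 : m 0 < e + 3 := not_le.1 fun h => hmT (isMultipleOf_of_le (hpow 0) h)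
    have h2 : m 1 < e + 3 := not_le.1 fun h => hmT (isMultipleOf_of_le (hpow 1) h)
    exact h0 (hc' m (by omega) (by omega))
  refine ⟨tensor (mulLin u (mulLin u b)) c - tensor (mulLin u b) (mulLin v c) +
    tensor b (mulLin v (mulLin v c)), ?_, ⟨Fin.append m m', ?_, ?_⟩, ?_⟩
  · intro m hm
    by_contra h
    refine hm ?_
    have t1 : tensor (mulLin u (mulLin u b)) c m = 0 := by
      by_contra h0; have := sum_of_tensor_ne_zero hdu2 hc m h0; omega
    have t2 : tensor (mulLin u b) (mulLin v c) m = 0 := by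
      by_contra h0; have := sum_of_tensor_ne_zero hdu1 hdv1 m h0; omega
    have t3 : tensor b (mulLin v (mulLin v c)) m = 0 := by
      by_contra h0; have := sum_of_tensor_ne_zero hb hdv2 m h0; omega
    simp [t1, t2, t3]
  · -- The three summands have different degrees in the first block of variables.
    have hdm := hdu2 m hm
    have t1 : mulLin u b m = 0 := by
      by_contra h0; have := hdu1 m h0; omega
    have t2 : b m = 0 := by
      by_contra h0; have := hb m h0; omega
    simp only [Pi.add_apply, Pi.sub_apply, tensor_append, t1, t2, zero_mul, sub_zero, add_zero]
    exact mul_ne_zero hm hm'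
  · rw [isMultipleOf_joinGenerators_append, not_or]
    exact ⟨not_isMultipleOf_of_lt hO (by rw [hdu2 m hm]; omega),
      not_isMultipleOf_of_lt hT (by rw [hc m' hm']; omega)⟩
  · intro m hm
    rw [isMultipleOf_joinGenerators, not_or] at hm
    simp only [map_add, map_sub, Pi.add_apply, Pi.sub_apply, mulLin_tensor]
    simp only [← hu_def, ← hv_def]
    have t1 : tensor (mulLin u (mulLin u (mulLin u b))) c m = 0 := by
      rw [tensor, hu3 _ hm.1, zero_mul]
    have t2 : tensor b (mulLin v (mulLin v (mulLin v c))) m = 0 := by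
      rw [tensor, hv3 _ hm.2, mul_zero]
    rw [t1, t2]
    ring

/-! ### Construction of the generators -/

/-- There are `μ` monomials of degree `d` in `n` variables, among them all pure powers, such that
for every linear form multiplication in a fixed degree is neither injective nor surjective. -/
def HasFailingGenerators (k : Type*) [Field k] (d n μ : ℕ) : Prop :=
  ∃ T : Finset (Fin n → ℕ), (∀ t ∈ T, ∑ i, t i = d) ∧ (∀ i, Pi.single i d ∈ T) ∧ T.card = μ ∧
    ∃ j, ∀ a : Fin n → k, FailsInjectivity a T j ∧ FailsSurjectivity a T (j + 1)

/-- Two more variables `x, y` bring at least their pure powers and at most two more generators. -/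
theorem HasFailingGenerators.add_two {k : Type*} [Field k] {d n μ : ℕ} (hd : 3 ≤ d)
    (h : HasFailingGenerators k d n μ) {r : ℕ} (hr : r ≤ 2) :
    HasFailingGenerators k d (n + 2) (μ + (2 + r)) := by
  obtain ⟨T, hT, hpow, hcard, j, hj⟩ := h
  obtain ⟨T', hT', hpow', hcard'⟩ := exists_pairGenerators hd hr
  obtain ⟨e, rfl⟩ : ∃ e, d = e + 1 := ⟨d - 1, by omega⟩
  refine ⟨joinGenerators T T', sum_of_mem_joinGenerators hT hT',
    single_mem_joinGenerators hpow hpow', ?_, j + e, fun a => ⟨?_, ?_⟩⟩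
  · rw [card_joinGenerators (by omega) hT, hcard, hcard']
  · exact (hj _).1.join (failsInjectivity_pair _ hT' hpow')
  · have := (hj fun i => a (Fin.castAdd 2 i)).2.join
      (failsSurjectivity_pair (fun i => a (Fin.natAdd n i)) hT')
    rwa [add_right_comm] at this

theorem hasFailingGenerators_four (k : Type*) [Field k] {d : ℕ} (hd : 3 ≤ d) :
    HasFailingGenerators k d 4 6 := by
  obtain ⟨T, hT, hpow, hcard⟩ := exists_pairGenerators hd (Nat.zero_le 2)
  obtain ⟨e, rfl⟩ : ∃ e, d = e + 3 := ⟨d - 3, by omega⟩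
  have hO := sum_of_mem_outerPair hd
  refine ⟨joinGenerators (outerPair (e + 3)) T, sum_of_mem_joinGenerators hO hT,
    single_mem_joinGenerators (single_mem_outerPair _) hpow, ?_, (e + 1) + (e + 2),
    fun a => ⟨failsInjectivity_outerPair_join a hT hpow, ?_⟩⟩
  · rw [card_joinGenerators (by omega) hO, hcard, card_outerPair hd]
  · have := (failsSurjectivity_pair (fun i : Fin 2 => a (Fin.castAdd 2 i)) hO).join
      (failsSurjectivity_pair (fun i : Fin 2 => a (Fin.natAdd 2 i)) hT)
    have h2 : e + 2 + (e + 2) = (e + 1) + (e + 2) + 1 := by omega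
    rwa [h2] at this

/-- If all `x_0 ^ (d - 1) * x_i` are among the generators, then every linear form kills
`x_0 ^ (d - 1)`, and the bound on `μ` says that the dimension does not drop from degree `d - 1` to
degree `d`. -/
theorem hasFailingGenerators_of_le {k : Type*} [Field k] {d n μ : ℕ} (hn : 1 ≤ n) (hd : 1 ≤ d)
    (h : 2 * n ≤ μ + 1) (h' : μ ≤ (n + d - 2).choose d) : HasFailingGenerators k d n μ := by
  obtain ⟨n, rfl⟩ : ∃ N, n = N + 1 := ⟨n - 1, by omega⟩
  obtain ⟨e, rfl⟩ : ∃ e, d = e + 1 := ⟨d - 1, by omega⟩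
  have hlt := card_antidiagonalTuple_add_le (n := n + 1) (d := e) (c := μ) (by omega)
    (by convert h' using 2; omega)
  let U : Finset (Fin (n + 1) → ℕ) :=
    Finset.univ.image (fun i : Fin (n + 1) => (Pi.single i (e + 1) : Fin (n + 1) → ℕ)) ∪
      Finset.univ.image (fun i : Fin n =>
        (Pi.single 0 e : Fin (n + 1) → ℕ) + (Pi.single i.succ 1 : Fin (n + 1) → ℕ))
  have hU : U ⊆ Finset.Nat.antidiagonalTuple (n + 1) (e + 1) := by
    intro t ht
    rw [Finset.Nat.mem_antidiagonalTuple]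
    rcases Finset.mem_union.1 ht with ht | ht
    · obtain ⟨i, -, rfl⟩ := Finset.mem_image.1 ht
      simp
    · obtain ⟨i, -, rfl⟩ := Finset.mem_image.1 ht
      rw [sum_add_single]
      simp
  have hUcard : U.card ≤ μ := by
    refine (Finset.card_union_le _ _).trans ?_
    have h1 := Finset.card_image_le (s := Finset.univ)
      (f := fun i : Fin (n + 1) => (Pi.single i (e + 1) : Fin (n + 1) → ℕ))
    have h2 := Finset.card_image_le (s := Finset.univ) (f := fun i : Fin n =>
      (Pi.single 0 e : Fin (n + 1) → ℕ) + (Pi.single i.succ 1 : Fin (n + 1) → ℕ))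
    rw [Finset.card_univ, Fintype.card_fin] at h1 h2
    omega
  obtain ⟨T, hUT, hT, hcard⟩ := Finset.exists_subsuperset_card_eq hU hUcard (by omega)
  have hTd : ∀ t ∈ T, ∑ i, t i = e + 1 := fun t ht =>
    Finset.Nat.mem_antidiagonalTuple.1 (hT ht)
  have hsocle : ∀ i, (Pi.single 0 e : Fin (n + 1) → ℕ) + Pi.single i 1 ∈ T := by
    intro i
    refine hUT (Finset.mem_union.2 ?_)
    refine Fin.cases (Or.inl ?_) (fun i => Or.inr ?_) i
    · exact Finset.mem_image.2 ⟨0, Finset.mem_univ _, by rw [Pi.single_add]⟩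
    · exact Finset.mem_image_of_mem _ (Finset.mem_univ i)
  have hinj : ∀ a : Fin (n + 1) → k, FailsInjectivity a T e := by
    intro a
    refine ⟨fun m => if m = Pi.single 0 e then 1 else 0, fun m hm => ?_,
      ⟨Pi.single 0 e, by simp, not_isMultipleOf_of_lt hTd (by simp)⟩, fun m hm => ?_⟩
    · have : m = Pi.single 0 e := by
        by_contra h; simp [h] at hm
      simp [this]
    · rw [mulLin_apply]
      refine Finset.sum_eq_zero fun i _ => ?_
      split_ifs with h0 h1
      · rfl
      · refine absurd ⟨_, hsocle i, ?_⟩ hm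
        rw [← h1, sub_single_add_single h0]
      · rw [mul_zero]
  refine ⟨T, hTd, fun i => ?_, hcard, e, fun a => ⟨hinj a, ?_⟩⟩
  · exact hUT (Finset.mem_union_left _ (Finset.mem_image_of_mem _ (Finset.mem_univ i)))
  · exact (hinj a).failsSurjectivity hTd (by omega)

/-- The four monomials of `x ^ 3 + y ^ 3 + z ^ 3 - 3 * x * y * z`, a multiple of `x + y + z`. -/
theorem hasFailingGenerators_three_three (k : Type*) [Field k] : HasFailingGenerators k 3 3 4 := by
  let T : Finset (Fin 3 → ℕ) := {![3, 0, 0], ![0, 3, 0], ![0, 0, 3], ![1, 1, 1]}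
  have hT : ∀ t ∈ T, ∑ i, t i = 2 + 1 := by decide
  have hcard : T.card = 4 := by decide
  have hinj : ∀ a : Fin 3 → k, FailsInjectivity a T 2 := by
    intro a
    by_cases ha : a = 0
    · refine ⟨fun m => if m = ![2, 0, 0] then 1 else 0, fun m hm => ?_,
        ⟨![2, 0, 0], by simp, not_isMultipleOf_of_lt hT (by decide)⟩,
        fun m _ => by simp [ha, mulLin_apply]⟩
      have : m = ![2, 0, 0] := by
        by_contra h; simp [h] at hm
      subst this
      decide
    open MvPolynomial in
    let L : Fin 3 → MvPolynomial (Fin 3) k := fun i => C (a i) * X i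
    have hL : ∀ i, (L i).IsHomogeneous 1 := fun i => MvPolynomial.isHomogeneous_C_mul_X _ _
    let p : MvPolynomial (Fin 3) k :=
      L 0 * L 0 + L 1 * L 1 + L 2 * L 2 - L 0 * L 1 - L 1 * L 2 - L 2 * L 0
    have hp : p.IsHomogeneous 2 :=
      ((((((hL 0).mul (hL 0)).add ((hL 1).mul (hL 1))).add ((hL 2).mul (hL 2))).sub
        ((hL 0).mul (hL 1))).sub ((hL 1).mul (hL 2))).sub ((hL 2).mul (hL 0))
    have hp0 : p ≠ 0 := by
      intro h0
      obtain ⟨i, hi⟩ := Function.ne_iff.1 ha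
      have := congrArg (MvPolynomial.eval (Pi.single i 1)) h0
      refine hi ?_
      fin_cases i <;> simpa [p, L] using this
    have hdeg : ∀ m : Fin 3 → ℕ,
        MvPolynomial.coeff (Finsupp.equivFunOnFinite.symm m) p ≠ 0 → ∑ i, m i = 2 := by
      intro m hm
      have := hp.coeff_eq_zero (d := Finsupp.equivFunOnFinite.symm m)
      by_contra h
      exact hm (this (by simpa [Finsupp.degree_eq_sum] using h))
    refine ⟨fun m => MvPolynomial.coeff (Finsupp.equivFunOnFinite.symm m) p, hdeg, ?_,
      fun m hm => ?_⟩
    · obtain ⟨m, hm⟩ := MvPolynomial.ne_zero_iff.1 hp0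
      refine ⟨Finsupp.equivFunOnFinite m, by simpa using hm, not_isMultipleOf_of_lt hT ?_⟩
      rw [hdeg _ (by simpa using hm)]
      omega
    · rw [← coeff_linearForm_mul]
      refine mem_monomialIdeal_exponents.1 ?_ m hm
      have hmem : ∀ t ∈ T, MvPolynomial.monomial (Finsupp.equivFunOnFinite.symm t) (1 : k) ∈
          monomialIdeal k (exponents T : Set (Fin 3 →₀ ℕ)) := fun t ht =>
        Ideal.subset_span ⟨_, by simpa [exponents] using ht, rfl⟩
      have hmon : ∀ t : Fin 3 → ℕ, MvPolynomial.monomial (Finsupp.equivFunOnFinite.symm t) (1 : k) =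
          MvPolynomial.X 0 ^ t 0 * MvPolynomial.X 1 ^ t 1 * MvPolynomial.X 2 ^ t 2 := by
        intro t
        rw [MvPolynomial.monomial_eq, Finsupp.prod_fintype _ _ (by simp), Fin.prod_univ_three]
        simp
      have h1 := hmem ![3, 0, 0] (by simp [T])
      have h2 := hmem ![0, 3, 0] (by simp [T])
      have h3 := hmem ![0, 0, 3] (by simp [T])
      have h4 := hmem ![1, 1, 1] (by simp [T])
      rw [hmon] at h1 h2 h3 h4
      simp only [Matrix.cons_val, pow_zero, pow_one, one_mul, mul_one] at h1 h2 h3 h4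
      have key : (∑ i, MvPolynomial.C (a i) * MvPolynomial.X i) * p =
          MvPolynomial.C (a 0) ^ 3 * MvPolynomial.X 0 ^ 3 +
          MvPolynomial.C (a 1) ^ 3 * MvPolynomial.X 1 ^ 3 +
          MvPolynomial.C (a 2) ^ 3 * MvPolynomial.X 2 ^ 3 -
          3 * MvPolynomial.C (a 0) * MvPolynomial.C (a 1) * MvPolynomial.C (a 2) *
            (MvPolynomial.X 0 * MvPolynomial.X 1 * MvPolynomial.X 2) := by
        rw [Fin.sum_univ_three]
        simp only [p, L]
        ring
      rw [key]
      exact sub_mem (add_mem (add_mem (Ideal.mul_mem_left _ _ h1) (Ideal.mul_mem_left _ _ h2))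
        (Ideal.mul_mem_left _ _ h3)) (Ideal.mul_mem_left _ _ h4)
  refine ⟨T, hT, by decide, hcard, 2, fun a => ⟨hinj a, (hinj a).failsSurjectivity hT ?_⟩⟩
  exact card_antidiagonalTuple_add_le (by omega) (by rw [hcard]; decide)

theorem hasFailingGenerators_five (k : Type*) [Field k] {d μ : ℕ} (hd : 3 ≤ d) (h : 7 ≤ μ)
    (h' : μ ≤ 8) : HasFailingGenerators k d 5 μ := by
  rcases hd.eq_or_lt with rfl | hd'
  · have := (hasFailingGenerators_three_three k).add_two le_rfl (r := μ - 6) (by omega)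
    rwa [show 4 + (2 + (μ - 6)) = μ by omega] at this
  · have h3 : HasFailingGenerators k d 3 5 := by
      refine hasFailingGenerators_of_le (by omega) (by omega) (by omega) ?_
      rw [show 3 + d - 2 = d + 1 by omega, Nat.choose_succ_self_right]
      omega
    have := h3.add_two hd (r := μ - 7) (by omega)
    rwa [show 5 + (2 + (μ - 7)) = μ by omega] at this

theorem hasFailingGenerators_of_le_two_mul (k : Type*) [Field k] {d : ℕ} (hd : 3 ≤ d) (n : ℕ)
    (hn : 4 ≤ n) : ∀ μ, n + 2 ≤ μ → μ + 2 ≤ 2 * n → HasFailingGenerators k d n μ := by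
  induction n using Nat.strong_induction_on with
  | _ n ih =>
    intro μ h h'
    rcases (by omega : n = 4 ∨ n = 5 ∨ 6 ≤ n) with rfl | rfl | hn6
    · rw [show μ = 6 by omega]
      exact hasFailingGenerators_four k hd
    · exact hasFailingGenerators_five k hd (by omega) (by omega)
    · obtain ⟨n, rfl⟩ : ∃ N, n = N + 2 := ⟨n - 2, by omega⟩
      -- All but at most two of the mixed generators go into the first `n` variables.
      obtain ⟨r, hr, h1, h2⟩ : ∃ r ≤ 2, n + 2 + (2 + r) ≤ μ ∧ μ + 2 ≤ 2 * n + (2 + r) := by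
        rcases le_total (μ + 2) (2 * n + 2) with hle | hle
        · exact ⟨0, by omega, by omega, by omega⟩
        · exact ⟨μ - 2 * n, by omega, by omega, by omega⟩
      have := (ih n (by omega) (by omega) (μ - (2 + r)) (by omega) (by omega)).add_two hd hr
      rwa [Nat.sub_add_cancel (by omega)] at this

theorem proposition4p9 (k : Type*) [Field k] [CharZero k] (n d μ : ℕ) (hn : 4 ≤ n) (hd : 3 ≤ d)
    (hμ : n + 2 ≤ μ) (hμ' : μ ≤ (n + d - 2).choose d) :
    ∃ I : Ideal (MvPolynomial (Fin n) k),
      IsMinimallyGeneratedByMonomials I d μ ∧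
      IsArtinianRing (MvPolynomial (Fin n) k ⧸ I) ∧
      ¬ HasWLP I := by
  have hgen : HasFailingGenerators k d n μ := by
    rcases le_or_gt (μ + 2) (2 * n) with h | h
    · exact hasFailingGenerators_of_le_two_mul k hd n hn μ hμ h
    · exact hasFailingGenerators_of_le (by omega) (by omega) (by omega) hμ'
  obtain ⟨T, hT, hpow, hcard, j, hj⟩ := hgen
  refine ⟨monomialIdeal k (exponents T : Set (Fin n →₀ ℕ)), ?_, ?_, not_hasWLP_of_fails hj⟩
  · have hdeg : ∀ m ∈ exponents T, m.degree = d := by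
      intro m hm
      obtain ⟨t, ht, rfl⟩ := Finset.mem_map.1 hm
      simpa [Finsupp.degree_eq_sum] using hT t ht
    have := isMinimallyGenerated_monomialIdeal k hdeg
    rwa [exponents, Finset.card_map, hcard] at this
  · refine isArtinianRing_quotient_of_X_pow_mem (d := d - 1) fun i => ?_
    rw [Nat.sub_add_cancel (by omega), MvPolynomial.X_pow_eq_monomial]
    refine Ideal.subset_span ⟨_, Finset.mem_map.2 ⟨_, hpow i, rfl⟩, ?_⟩
    congr 2
    ext l
    simp [Finsupp.single_apply]
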